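/- Let $V$ be a $3$-dimensional vector space over $F=\mathrm{GF}(3)$, let $W=V\vee V$ be its symmetric square, and let $\mathrm{PG}(2,3)$ and $\mathrm{PG}(5,3)$ be the projective spaces on $V$ and $W$. Let $\varphi$ be the Veronese mapping $Fa\mapsto F(a\vee a)$ from the points of $\mathrm{PG}(2,3)$ to the points of $\mathrm{PG}(5,3)$. Fix an arbitrary line $l_\infty$ of $\mathrm{PG}(2,3)$. Its image $\varphi(l_\infty)$ is a planar quadrangle; let $\Delta_\infty$ be the diagonal triangle of this quadrangle, i.e. the set of points of intersection of its opposite sides, and put $$K=\bigl(\operatorname{im}\varphi\setminus\varphi(l_\infty)\bigr)\cup\Delta_\infty .$$ For a set $K'$ of points of $\mathrm{PG}(5,3)$, a *block* of $K'$ is a set $H\cap K'$, where $H$ is a hyperplane of $\mathrm{PG}(5,3)$, that contains more than three points. Let $\mathcal B(K')$ be the set of all blocks of $K'$. 1. $(K,\mathcal B(K),\in)$ is a $5$-$(12,6,1)$ design: $K$ has $12$ points, each block has exactly $6$ points, and any $5$ points of $K$ lie in exactly one block. 2. This design is (isomorphic to) Witt's design $W_{12}$, i.e. the design with point set $\mathrm{GF}(11)\cup\{\infty\}$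 whose blocks are the images of $\{\infty,1,3,4,5,9\}$ under the maps $x\mapsto (ax+b)/(cx+d)$ with $a,b,c,d\in\mathrm{GF}(11)$ and $ad-bc=1$. 3. Such a point model is projectively unique: if $K'$ is any set of points of $\mathrm{PG}(5,3)$ such that $(K',\mathcal B(K'),\in)$ is a $5$-$(12,6,1)$ design, then some projective collineation of $\mathrm{PG}(5,3)$ takes $K$ to $K'$. -/

import Mathlib

open scoped LinearAlgebra.Projectivization TensorProduct

noncomputable section

namespace WittVeronese

/-! ### Designs -/

/-- The incidence structure with point set `X`, block set `B` and incidence `∈` is a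
`t`-`(v, k, l)` design: there are `v` points, each block is a set of `k` points, and any `t`
points lie together in exactly `l` blocks. -/
structure IsDesign {P : Type*} (t v k l : ℕ) (X : Set P) (B : Set (Set P)) : Prop where
  card_points : X.encard = v
  block_subset : ∀ b ∈ B, b ⊆ X
  card_block : ∀ b ∈ B, b.encard = k
  card_through : ∀ S : Set P, S ⊆ X → S.encard = t → {b ∈ B | S ⊆ b}.encard = l

/-- Isomorphism of the incidence structures `(X, B, ∈)` and `(Y, C, ∈)`: a bijection of the
points that maps the set of blocks onto the set of blocks. -/
def DesignIso {P Q : Type*} (X : Set P) (B : Set (Set P)) (Y : Set Q) (C : Set (Set Q)) : Prop :=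
  ∃ f : P → Q, Set.BijOn f X Y ∧ (fun b => f '' b) '' B = C

instance factPrimeEleven : Fact (Nat.Prime 11) := ⟨by norm_num⟩

/-- The non-zero squares of `GF(11)` together with `∞`. -/
def baseBlock : Set (OnePoint (ZMod 11)) :=
  insert OnePoint.infty ((fun x : ZMod 11 => (x : OnePoint (ZMod 11))) '' {1, 3, 4, 5, 9})

/-- The blocks of Witt's design `W₁₂`, whose points are those of the projective line
`GF(11) ∪ {∞}`: the images of the base block under the maps `x ↦ (ax + b) / (cx + d)` with
`ad - bc = 1`, that is, under `PSL(2, 11)`. -/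
def wittBlocks : Set (Set (OnePoint (ZMod 11))) :=
  Set.range fun g : Matrix.SpecialLinearGroup (Fin 2) (ZMod 11) =>
    (fun x : OnePoint (ZMod 11) => (g : Matrix.GeneralLinearGroup (Fin 2) (ZMod 11)) • x) ''
      baseBlock

/-! ### Projective geometry over `GF(3)` -/

section Projective

variable {W : Type*} [AddCommGroup W] [Module (ZMod 3) W]

/-- The set of points of the projective subspace given by a linear subspace `H`. -/
def pointsOf (H : Submodule (ZMod 3) W) : Set (ℙ (ZMod 3) W) :=
  {p | p.submodule ≤ H}

/-- The blocks of a set `K` of points: the hyperplane sections of `K` that contain more than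
three points. A hyperplane is given by a maximal proper linear subspace. -/
def blocks (K : Set (ℙ (ZMod 3) W)) : Set (Set (ℙ (ZMod 3) W)) :=
  {b | (∃ H : Submodule (ZMod 3) W, IsCoatom H ∧ b = K ∩ pointsOf H) ∧ 3 < b.encard}

/-- The diagonal points of a quadrangle `G`: the points of intersection of opposite sides. -/
def diagonalPoints (G : Set (ℙ (ZMod 3) W)) : Set (ℙ (ZMod 3) W) :=
  {x | ∃ a b c d : ℙ (ZMod 3) W,
    a ≠ b ∧ a ≠ c ∧ a ≠ d ∧ b ≠ c ∧ b ≠ d ∧ c ≠ d ∧ G = {a, b, c, d} ∧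
      x.submodule ≤ a.submodule ⊔ b.submodule ∧ x.submodule ≤ c.submodule ⊔ d.submodule}

/-- Two sets of points are projectively equivalent: some projective collineation, induced by a
linear bijection, takes the first one to the second one. (All collineations are of this kind,
as `GF(3)` has no automorphism other than the identity.) -/
def ProjectivelyEquivalent (K K' : Set (ℙ (ZMod 3) W)) : Prop :=
  ∃ g : W ≃ₗ[ZMod 3] W, Projectivization.map g.toLinearMap g.injective '' K = K'

end Projective

/-! ### The Veronese surface -/

section Veronese

variable {V : Type*} [AddCommGroup V] [Module (ZMod 3) V]

/-- The symmetric square `a ∨ a` of a vector. -/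
def symSq (a : V) : Sym[ZMod 3]^2 V :=
  SymmetricPower.tprod (ZMod 3) (ι := Fin 2) fun _ => a

theorem symSq_smul (t : ZMod 3) (a : V) : symSq (t • a) = t ^ 2 • symSq a := by
  have h := (SymmetricPower.tprod (ZMod 3) (ι := Fin 2) (M := V)).map_smul_univ
    (fun _ => t) (fun _ => a)
  simpa [symSq] using h

theorem symSq_ne_zero {a : V} (ha : a ≠ 0) : symSq a ≠ 0 := by
  obtain ⟨f, hf⟩ : ∃ f : Module.Dual (ZMod 3) V, f a ≠ 0 := by
    by_contra! h
    exact ha ((Module.forall_dual_apply_eq_zero_iff (ZMod 3) a).1 h)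
  let m : (⨂[ZMod 3] _ : Fin 2, V) →ₗ[ZMod 3] ZMod 3 := PiTensorProduct.lift
    ((MultilinearMap.mkPiAlgebra (ZMod 3) (Fin 2) (ZMod 3)).compLinearMap fun _ => f)
  have hm : addConGen (SymmetricPower.Rel (ZMod 3) (Fin 2) V) ≤ AddCon.ker m.toAddMonoidHom := by
    refine AddCon.addConGen_le.2 ?_
    rintro _ _ ⟨e, v⟩
    simp only [AddCon.ker_rel]
    simpa [m] using (Equiv.prod_comp e fun i => f (v i)).symm
  let g : Sym[ZMod 3]^2 V →+ ZMod 3 := AddCon.lift _ m.toAddMonoidHom hm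
  have hg : g (symSq a) = f a * f a := by
    change m (PiTensorProduct.tprod (ZMod 3) fun _ => a) = _
    simp [m, pow_two]
  intro h
  rw [h, map_zero] at hg
  exact mul_ne_zero hf hf hg.symm

/-- The Veronese mapping `F a ↦ F (a ∨ a)`. -/
def veronese (p : ℙ (ZMod 3) V) : ℙ (ZMod 3) (Sym[ZMod 3]^2 V) :=
  Projectivization.lift
    (fun a : {a : V // a ≠ 0} => Projectivization.mk (ZMod 3) (symSq a.1) (symSq_ne_zero a.2))
    (by
      rintro ⟨a, ha⟩ ⟨b, hb⟩ t (rfl : a = t • b)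
      rw [Projectivization.mk_eq_mk_iff']
      exact ⟨t ^ 2, (symSq_smul t b).symm⟩) p

/-- The set obtained from the Veronese surface by replacing the quadrangle that is the image of
the line `L` with its diagonal triangle. -/
def modelK (L : Submodule (ZMod 3) V) : Set (ℙ (ZMod 3) (Sym[ZMod 3]^2 V)) :=
  (Set.range veronese \ (veronese '' pointsOf L)) ∪ diagonalPoints (veronese '' pointsOf L)

end Veronese

end WittVeronese

end

noncomputable section

namespace WittVeronese

/-! ### Words over `GF(3)` -/

/-! The proof is coding theory over GF(3). Evaluate the linear forms of a 6-dimensional space on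
vectors spanning twelve points. If six of these vectors form a basis and the other six have
coordinate matrix `A`, the values form the code of words `(a, Aa)`, and hyperplane sections are the
zero sets of nonzero words. "Each block has six points" then says that a nonzero word with more than
three zeros has exactly six (`IsExtremal`).

Two facts about zeros of ternary words carry everything. First, x - y, x + y, x, y have together n +
3m zeros, where n is the length and m the number of common zeros of x and y. Second, x · y is the
difference of the zero counts of x - y and x + y. For an extremal code the first fact shows that two
words with five common zeros are proportional. With the dimension count that five points lie in a
hyperplane, this gives the 5-design.

Conversely, a point model spans the space, since otherwise all twelve points would form one block;
so it yields a matrix `A`. Applied to unit vectors and their sums and differences, extremality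
forces one zero in each column, in different rows, and orthogonal columns. Normalising signs leaves
a finite problem whose only solution up to permutation is the conference matrix `conf`, whose code
is the extended ternary Golay code (`IsExtremal.exists_eq_conf`). Hence every point model is
`golaySet` in some basis, and any two are projectively equivalent.

It remains to identify `golaySet` with Witt's design, by labelling its points with the projective
line over GF(11), and to find a basis in which the Veronese model is `golaySet`. -/

/-- The positions at which a word vanishes. -/
def zeros {ι : Type*} [Fintype ι] (w : ι → ZMod 3) : Finset ι :=
  Finset.univ.filter fun i => w i = 0

section Words

variable {ι : Type*} [Fintype ι]

@[simp]
theorem mem_zeros {w : ι → ZMod 3} {i : ι} : i ∈ zeros w ↔ w i = 0 := by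
  simp [zeros]

theorem card_zeros_eq_sum (w : ι → ZMod 3) :
    (zeros w).card = ∑ i, if w i = 0 then 1 else 0 := by
  rw [zeros, Finset.card_filter]

/-- At each position exactly one of a = b, a = -b, a = 0, b = 0 holds, because the projective line
over GF(3) has four points; if a = b = 0, all four hold, which adds three. -/
theorem card_zeros_sub_add_card_zeros_add [DecidableEq ι] (x y : ι → ZMod 3) :
    (zeros (x - y)).card + (zeros (x + y)).card + (zeros x).card + (zeros y).card =
      Fintype.card ι + 3 * (zeros x ∩ zeros y).card := by
  have h : (zeros x ∩ zeros y).card = ∑ i, if x i = 0 ∧ y i = 0 then 1 else 0 := by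
    rw [← Finset.card_filter]
    congr 1
    ext i
    simp
  have hc : Fintype.card ι = ∑ _i : ι, 1 := by simp
  rw [h, hc, Finset.mul_sum]
  simp only [card_zeros_eq_sum, ← Finset.sum_add_distrib]
  refine Finset.sum_congr rfl fun i _ => ?_
  have h : ∀ a b : ZMod 3, (((if a - b = 0 then 1 else 0) + if a + b = 0 then 1 else 0) +
      if a = 0 then 1 else 0) + (if b = 0 then 1 else 0) =
        1 + 3 * if a = 0 ∧ b = 0 then 1 else 0 := by
    decide
  exact h (x i) (y i)

/-- A product ab is 1 if a = b ≠ 0 and -1 if a = -b ≠ 0. Positions with a = b = 0 cancel. -/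
theorem dotProduct_eq_card_sub_card (x y : ι → ZMod 3) :
    x ⬝ᵥ y = (zeros (x - y)).card - (zeros (x + y)).card := by
  simp only [card_zeros_eq_sum, Nat.cast_sum, ← Finset.sum_sub_distrib, dotProduct]
  refine Finset.sum_congr rfl fun i _ => ?_
  have h : ∀ a b : ZMod 3, a * b =
      ((if a - b = 0 then 1 else 0 : ℕ) : ZMod 3) - ((if a + b = 0 then 1 else 0 : ℕ) : ZMod 3) := by
    decide
  exact h (x i) (y i)

theorem card_zeros_sumElim {κ : Type*} [Fintype κ] (x : ι → ZMod 3) (y : κ → ZMod 3) :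
    (zeros (Sum.elim x y)).card = (zeros x).card + (zeros y).card := by
  simp only [card_zeros_eq_sum, Fintype.sum_sum_type, Sum.elim_inl, Sum.elim_inr]
  rfl

end Words

/-! ### The conference matrix of order six -/

/-- The normalised symmetric conference matrix of order six, whose core comes from the pentagon. -/
def conf : Matrix (Fin 6) (Fin 6) (ZMod 3) :=
  !![0, 1, 1, 1, 1, 1;
     1, 0, 1, -1, -1, 1;
     1, 1, 0, 1, -1, -1;
     1, -1, 1, 0, 1, -1;
     1, -1, -1, 1, 0, 1;
     1, 1, -1, -1, 1, 0]

/-- The codeword with message `a` of the code with generator matrix `(I | Aᵀ)`. -/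
def word (A : Matrix (Fin 6) (Fin 6) (ZMod 3)) (a : Fin 6 → ZMod 3) : Fin 6 ⊕ Fin 6 → ZMod 3 :=
  Sum.elim a (A.mulVec a)

/-- Six scalar quantifiers are cheaper for kernel evaluation than one over functions. -/
theorem forall_fin_six_iff {p : (Fin 6 → ZMod 3) → Prop} :
    (∀ a, p a) ↔ ∀ a b c d e f : ZMod 3, p ![a, b, c, d, e, f] := by
  refine ⟨fun h _ _ _ _ _ _ => h _, fun h a => ?_⟩
  convert! h (a 0) (a 1) (a 2) (a 3) (a 4) (a 5)
  ext i
  fin_cases i <;> rfl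

/-- The codewords of the code with generator matrix `(I | confᵀ)`. -/
def codeword (a b c d e f : ZMod 3) : Fin 6 ⊕ Fin 6 → ZMod 3 :=
  Sum.elim ![a, b, c, d, e, f] ![b + c + d + e + f, a + c - d - e + f, a + b + d - e - f,
    a - b + c + e - f, a - b - c + d + f, a + b - c - d + e]

theorem word_conf (a b c d e f : ZMod 3) :
    word conf ![a, b, c, d, e, f] = codeword a b c d e f := by
  ext (i | k)
  · rfl
  · fin_cases k <;> simp [word, codeword, conf, Matrix.vecHead, Matrix.vecTail] <;> ring

/-- These are the weights 12, 9 and 6 of the extended ternary Golay code. -/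
theorem card_zeros_word_conf : ∀ a : Fin 6 → ZMod 3, a ≠ 0 →
    (zeros (word conf a)).card = 0 ∨ (zeros (word conf a)).card = 3 ∨
      (zeros (word conf a)).card = 6 := by
  rw [forall_fin_six_iff]
  simp only [word_conf]
  decide +kernel

set_option synthInstance.maxHeartbeats 2000000 in
set_option synthInstance.maxSize 100000 in
set_option maxRecDepth 100000 in
set_option maxHeartbeats 2000000 in
-- The letters a, ..., e are the columns of the core. Zero column sum is orthogonality to the
-- bordering column; the summand 1 in the other equations comes from the bordering row. Each
-- equation stands as soon as its variables are bound, so that the search is pruned early.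
theorem exists_perm_core :
    ∀ a₁, a₁ ≠ 0 → ∀ a₂, a₂ ≠ 0 → ∀ a₃, a₃ ≠ 0 → ∀ a₄ : ZMod 3, a₄ ≠ 0 → a₁ + a₂ + a₃ + a₄ = 0 →
    ∀ b₀, b₀ ≠ 0 → ∀ b₂, b₂ ≠ 0 → ∀ b₃, b₃ ≠ 0 → ∀ b₄ : ZMod 3, b₄ ≠ 0 → b₀ + b₂ + b₃ + b₄ = 0 →
      1 + a₂ * b₂ + a₃ * b₃ + a₄ * b₄ = 0 →
    ∀ c₀, c₀ ≠ 0 → ∀ c₁, c₁ ≠ 0 → ∀ c₃, c₃ ≠ 0 → ∀ c₄ : ZMod 3, c₄ ≠ 0 → c₀ + c₁ + c₃ + c₄ = 0 →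
      1 + a₁ * c₁ + a₃ * c₃ + a₄ * c₄ = 0 → 1 + b₀ * c₀ + b₃ * c₃ + b₄ * c₄ = 0 →
    ∀ d₀, d₀ ≠ 0 → ∀ d₁, d₁ ≠ 0 → ∀ d₂, d₂ ≠ 0 → ∀ d₄ : ZMod 3, d₄ ≠ 0 → d₀ + d₁ + d₂ + d₄ = 0 →
      1 + a₁ * d₁ + a₂ * d₂ + a₄ * d₄ = 0 → 1 + b₀ * d₀ + b₂ * d₂ + b₄ * d₄ = 0 →
      1 + c₀ * d₀ + c₁ * d₁ + c₄ * d₄ = 0 →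
    ∀ e₀, e₀ ≠ 0 → ∀ e₁, e₁ ≠ 0 → ∀ e₂, e₂ ≠ 0 → ∀ e₃ : ZMod 3, e₃ ≠ 0 → e₀ + e₁ + e₂ + e₃ = 0 →
      1 + a₁ * e₁ + a₂ * e₂ + a₃ * e₃ = 0 → 1 + b₀ * e₀ + b₂ * e₂ + b₃ * e₃ = 0 →
      1 + c₀ * e₀ + c₁ * e₁ + c₃ * e₃ = 0 → 1 + d₀ * e₀ + d₁ * e₁ + d₂ * e₂ = 0 →
    ∃ π : Equiv.Perm (Fin 5), ∀ i j,
      (!![0, b₀, c₀, d₀, e₀; a₁, 0, c₁, d₁, e₁; a₂, b₂, 0, d₂, e₂; a₃, b₃, c₃, 0, e₃;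
        a₄, b₄, c₄, d₄, 0] : Matrix (Fin 5) (Fin 5) (ZMod 3)) (π i) (π j) =
        conf i.succ j.succ := by
  decide +kernel

/-- Every non-zero codeword with more than three zeros has exactly six zeros. -/
def IsExtremal (A : Matrix (Fin 6) (Fin 6) (ZMod 3)) : Prop :=
  ∀ a, a ≠ 0 → 3 < (zeros (word A a)).card → (zeros (word A a)).card = 6

theorem isExtremal_conf : IsExtremal conf := fun a ha h => by
  rcases card_zeros_word_conf a ha with h' | h' | h' <;> omega

theorem mul_self_eq_one : ∀ {a : ZMod 3}, a ≠ 0 → a * a = 1 := by decide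

/-! ### Zeros and orthogonality of the columns of an extremal matrix -/

section Extremal

variable {A : Matrix (Fin 6) (Fin 6) (ZMod 3)}

theorem IsExtremal.card_zeros_mulVec (hA : IsExtremal A) {a : Fin 6 → ZMod 3} (ha : a ≠ 0)
    (h : 3 < (zeros a).card) : (zeros (A.mulVec a)).card = 6 - (zeros a).card := by
  have := hA a ha (by rw [word, card_zeros_sumElim]; omega)
  rw [word, card_zeros_sumElim] at this
  omega

theorem IsExtremal.card_zeros_col (hA : IsExtremal A) (j : Fin 6) :
    (zeros (A.col j)).card = 1 := by
  have h : ∀ j : Fin 6, (zeros (Pi.single j 1 : Fin 6 → ZMod 3)).card = 5 := by decide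
  have := hA.card_zeros_mulVec (a := Pi.single j 1) (by simp) (by rw [h]; norm_num)
  rwa [h, Matrix.mulVec_single_one] at this

theorem IsExtremal.card_zeros_col_sub (hA : IsExtremal A) {i j : Fin 6} (hij : i ≠ j) :
    (zeros (A.col i - A.col j)).card = 2 := by
  have h : ∀ i j : Fin 6, i ≠ j →
      (zeros (Pi.single i 1 - Pi.single j 1 : Fin 6 → ZMod 3)).card = 4 := by decide
  have := hA.card_zeros_mulVec (a := Pi.single i 1 - Pi.single j 1)
    (fun h0 => by simpa [hij] using congrFun h0 i) (by rw [h i j hij]; norm_num)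
  rwa [h i j hij, Matrix.mulVec_sub, Matrix.mulVec_single_one, Matrix.mulVec_single_one] at this

theorem IsExtremal.card_zeros_col_add (hA : IsExtremal A) {i j : Fin 6} (hij : i ≠ j) :
    (zeros (A.col i + A.col j)).card = 2 := by
  have h : ∀ i j : Fin 6, i ≠ j →
      (zeros (Pi.single i 1 + Pi.single j 1 : Fin 6 → ZMod 3)).card = 4 := by decide
  have := hA.card_zeros_mulVec (a := Pi.single i 1 + Pi.single j 1)
    (fun h0 => by simpa [hij] using congrFun h0 i) (by rw [h i j hij]; norm_num)
  rwa [h i j hij, Matrix.mulVec_add, Matrix.mulVec_single_one, Matrix.mulVec_single_one] at this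

/-- The zero count identity reads 2 + 2 + 1 + 1 = 6 + 3m. -/
theorem IsExtremal.zeros_col_inter (hA : IsExtremal A) {i j : Fin 6} (hij : i ≠ j) :
    zeros (A.col i) ∩ zeros (A.col j) = ∅ := by
  have := card_zeros_sub_add_card_zeros_add (A.col i) (A.col j)
  rw [hA.card_zeros_col_sub hij, hA.card_zeros_col_add hij, hA.card_zeros_col,
    hA.card_zeros_col, Fintype.card_fin] at this
  exact Finset.card_eq_zero.1 (by omega)

theorem IsExtremal.col_dotProduct_col (hA : IsExtremal A) {i j : Fin 6} (hij : i ≠ j) :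
    A.col i ⬝ᵥ A.col j = 0 := by
  rw [dotProduct_eq_card_sub_card, hA.card_zeros_col_sub hij, hA.card_zeros_col_add hij, sub_self]

end Extremal

theorem exists_perm_of_normalised {B : Matrix (Fin 6) (Fin 6) (ZMod 3)}
    (hd : ∀ k j, B k j = 0 ↔ k = j) (hr : ∀ j, j ≠ 0 → B 0 j = 1) (hc : ∀ k, k ≠ 0 → B k 0 = 1)
    (ho : ∀ i j, i ≠ j → B.col i ⬝ᵥ B.col j = 0) :
    ∃ π : Equiv.Perm (Fin 6), ∀ k j, B (π k) (π j) = conf k j := by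
  have h0 : ∀ k, B k k = 0 := fun k => (hd k k).2 rfl
  have hn : ∀ k j, k ≠ j → B k j ≠ 0 := fun k j h h' => h ((hd k j).1 h')
  have ho' : ∀ i j, i ≠ j → B 0 i * B 0 j + B 1 i * B 1 j + B 2 i * B 2 j + B 3 i * B 3 j +
      B 4 i * B 4 j + B 5 i * B 5 j = 0 := fun i j h => by
    simpa [dotProduct, Fin.sum_univ_six] using ho i j h
  have r1 := hr 1 (by decide)
  have r2 := hr 2 (by decide)
  have r3 := hr 3 (by decide)
  have r4 := hr 4 (by decide)
  have r5 := hr 5 (by decide)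
  have c1 := hc 1 (by decide)
  have c2 := hc 2 (by decide)
  have c3 := hc 3 (by decide)
  have c4 := hc 4 (by decide)
  have c5 := hc 5 (by decide)
  obtain ⟨π, hπ⟩ := exists_perm_core
    (B 2 1) (hn _ _ (by decide)) (B 3 1) (hn _ _ (by decide))
    (B 4 1) (hn _ _ (by decide)) (B 5 1) (hn _ _ (by decide))
    (by simpa [h0, r1, r2, r3, r4, r5, c1, c2, c3, c4, c5] using ho' 0 1 (by decide))
    (B 1 2) (hn _ _ (by decide)) (B 3 2) (hn _ _ (by decide))
    (B 4 2) (hn _ _ (by decide)) (B 5 2) (hn _ _ (by decide))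
    (by simpa [h0, r1, r2, r3, r4, r5, c1, c2, c3, c4, c5] using ho' 0 2 (by decide))
    (by simpa [h0, r1, r2, r3, r4, r5, c1, c2, c3, c4, c5] using ho' 1 2 (by decide))
    (B 1 3) (hn _ _ (by decide)) (B 2 3) (hn _ _ (by decide))
    (B 4 3) (hn _ _ (by decide)) (B 5 3) (hn _ _ (by decide))
    (by simpa [h0, r1, r2, r3, r4, r5, c1, c2, c3, c4, c5] using ho' 0 3 (by decide))
    (by simpa [h0, r1, r2, r3, r4, r5, c1, c2, c3, c4, c5] using ho' 1 3 (by decide))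
    (by simpa [h0, r1, r2, r3, r4, r5, c1, c2, c3, c4, c5] using ho' 2 3 (by decide))
    (B 1 4) (hn _ _ (by decide)) (B 2 4) (hn _ _ (by decide))
    (B 3 4) (hn _ _ (by decide)) (B 5 4) (hn _ _ (by decide))
    (by simpa [h0, r1, r2, r3, r4, r5, c1, c2, c3, c4, c5] using ho' 0 4 (by decide))
    (by simpa [h0, r1, r2, r3, r4, r5, c1, c2, c3, c4, c5] using ho' 1 4 (by decide))
    (by simpa [h0, r1, r2, r3, r4, r5, c1, c2, c3, c4, c5] using ho' 2 4 (by decide))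
    (by simpa [h0, r1, r2, r3, r4, r5, c1, c2, c3, c4, c5] using ho' 3 4 (by decide))
    (B 1 5) (hn _ _ (by decide)) (B 2 5) (hn _ _ (by decide))
    (B 3 5) (hn _ _ (by decide)) (B 4 5) (hn _ _ (by decide))
    (by simpa [h0, r1, r2, r3, r4, r5, c1, c2, c3, c4, c5] using ho' 0 5 (by decide))
    (by simpa [h0, r1, r2, r3, r4, r5, c1, c2, c3, c4, c5] using ho' 1 5 (by decide))
    (by simpa [h0, r1, r2, r3, r4, r5, c1, c2, c3, c4, c5] using ho' 2 5 (by decide))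
    (by simpa [h0, r1, r2, r3, r4, r5, c1, c2, c3, c4, c5] using ho' 3 5 (by decide))
    (by simpa [h0, r1, r2, r3, r4, r5, c1, c2, c3, c4, c5] using ho' 4 5 (by decide))
  have hM : ∀ i j : Fin 5, B i.succ j.succ =
      (!![0, B 1 2, B 1 3, B 1 4, B 1 5; B 2 1, 0, B 2 3, B 2 4, B 2 5;
        B 3 1, B 3 2, 0, B 3 4, B 3 5; B 4 1, B 4 2, B 4 3, 0, B 4 5;
        B 5 1, B 5 2, B 5 3, B 5 4, 0] : Matrix (Fin 5) (Fin 5) (ZMod 3)) i j := by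
    intro i j
    fin_cases i <;> fin_cases j <;> first | rfl | exact h0 _
  -- This permutation fixes the border index 0 and acts as `π` on the core.
  refine ⟨Equiv.Perm.decomposeFin.symm (0, π), fun k j => ?_⟩
  refine Fin.cases ?_ (fun k => ?_) k <;> refine Fin.cases ?_ (fun j => ?_) j <;>
    simp only [Equiv.Perm.decomposeFin_symm_apply_zero, Equiv.Perm.decomposeFin_symm_apply_succ,
      Equiv.swap_self, Equiv.refl_apply]
  · exact h0 0
  · rw [hr _ (Fin.succ_ne_zero _)]
    fin_cases j <;> rfl
  · rw [hc _ (Fin.succ_ne_zero _)]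
    fin_cases k <;> rfl
  · rw [hM, hπ]

/-- An extremal matrix is equivalent to the conference matrix by permutations and changes of sign
of the rows and columns. -/
theorem IsExtremal.exists_eq_conf {A : Matrix (Fin 6) (Fin 6) (ZMod 3)} (hA : IsExtremal A) :
    ∃ (σ τ : Equiv.Perm (Fin 6)) (s t : Fin 6 → ZMod 3), (∀ k, s k ≠ 0) ∧ (∀ j, t j ≠ 0) ∧
      ∀ k j, A (σ k) (τ j) = s k * t j * conf k j := by
  choose z hz using fun j => Finset.card_eq_one.1 (hA.card_zeros_col j)
  have hz' : ∀ k j, A k j = 0 ↔ k = z j := fun k j => by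
    rw [← Finset.mem_singleton (a := z j), ← hz j, mem_zeros, Matrix.col_apply]
  have hinj : Function.Injective z := fun i j h => by
    by_contra hij
    have := hA.zeros_col_inter hij
    rw [hz, hz, h, Finset.inter_self] at this
    exact Finset.singleton_ne_empty _ this
  -- Permuting the rows by `ζ` puts the zeros on the diagonal.
  let ζ : Equiv.Perm (Fin 6) := Equiv.ofBijective z (Finite.injective_iff_bijective.1 hinj)
  have hd : ∀ k j, A (ζ k) j = 0 ↔ k = j := fun k j => (hz' _ _).trans hinj.eq_iff
  -- Nonzero scalars are their own inverses, so scaling by the border entries turns the border into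
  -- ones. The corner entry is 0, hence the separate value 1 at index 0.
  let r : Fin 6 → ZMod 3 := fun k => if k = 0 then 1 else A (ζ k) 0
  let c : Fin 6 → ZMod 3 := fun j => if j = 0 then 1 else A (ζ 0) j
  have hr : ∀ k, r k ≠ 0 := fun k => by
    by_cases h : k = 0
    · simp [r, h]
    · simp [r, h, hd]
  have hc : ∀ j, c j ≠ 0 := fun j => by
    by_cases h : j = 0
    · simp [c, h]
    · simp [c, hd, eq_comm, h]
  obtain ⟨π, hπ⟩ := exists_perm_of_normalised (B := Matrix.of fun k j => r k * c j * A (ζ k) j)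
    (fun k j => by simp [hr, hc, hd])
    (fun j hj => by
      simpa [r, c, hj] using mul_self_eq_one (a := A (ζ 0) j) (by simpa [hd] using hj.symm))
    (fun k hk => by
      simpa [r, c, hk] using mul_self_eq_one (a := A (ζ k) 0) (by simpa [hd] using hk))
    (fun i j hij => by
      have h : ∑ k, A (ζ k) i * A (ζ k) j = 0 :=
        (Equiv.sum_comp ζ fun k => A k i * A k j).trans (hA.col_dotProduct_col hij)
      have h2 : ∀ k, r k * c i * A (ζ k) i * (r k * c j * A (ζ k) j) =
          c i * c j * (A (ζ k) i * A (ζ k) j) := fun k => by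
        linear_combination c i * c j * (A (ζ k) i * A (ζ k) j) * mul_self_eq_one (hr k)
      simp only [dotProduct, Matrix.col_apply, Matrix.of_apply, h2, ← Finset.mul_sum, h, mul_zero])
  refine ⟨π.trans ζ, π, r ∘ π, c ∘ π, fun k => hr _, fun j => hc _, fun k j => ?_⟩
  rw [← hπ]
  simp only [Equiv.trans_apply, Function.comp_apply, Matrix.of_apply]
  have h1 := mul_self_eq_one (hr (π k))
  have h2 := mul_self_eq_one (hc (π j))
  linear_combination (-A (ζ (π k)) (π j)) * (h2 + c (π j) * c (π j) * h1)

theorem IsExtremal.card_zeros_word_le {A : Matrix (Fin 6) (Fin 6) (ZMod 3)} (hA : IsExtremal A)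
    {a : Fin 6 → ZMod 3} (ha : a ≠ 0) : (zeros (word A a)).card ≤ 6 := by
  by_contra! h
  have := hA a ha (by omega)
  omega

theorem word_sub (A : Matrix (Fin 6) (Fin 6) (ZMod 3)) (a b : Fin 6 → ZMod 3) :
    word A (a - b) = word A a - word A b := by
  ext (i | i) <;> simp [word, Matrix.mulVec_sub]

theorem word_add (A : Matrix (Fin 6) (Fin 6) (ZMod 3)) (a b : Fin 6 → ZMod 3) :
    word A (a + b) = word A a + word A b := by
  ext (i | i) <;> simp [word, Matrix.mulVec_add]

/-- Two blocks of an extremal code with five common points are equal. -/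
theorem IsExtremal.zeros_word_eq {A : Matrix (Fin 6) (Fin 6) (ZMod 3)} (hA : IsExtremal A)
    {a b : Fin 6 → ZMod 3} (ha : a ≠ 0) (hb : b ≠ 0)
    (h : 5 ≤ (zeros (word A a) ∩ zeros (word A b)).card) :
    zeros (word A a) = zeros (word A b) := by
  have hca := Finset.card_le_card
    (Finset.inter_subset_left (s₁ := zeros (word A a)) (s₂ := zeros (word A b)))
  have hcb := Finset.card_le_card
    (Finset.inter_subset_right (s₁ := zeros (word A a)) (s₂ := zeros (word A b)))
  have ha6 := hA a ha (by omega)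
  have hb6 := hA b hb (by omega)
  -- The words of a - b and a + b have together at least 12 + 15 - 12 = 15 zeros, while two nonzero
  -- words have at most 12. So a = ±b.
  have hcount := card_zeros_sub_add_card_zeros_add (word A a) (word A b)
  rw [← word_sub, ← word_add, ha6, hb6] at hcount
  by_cases h1 : a - b = 0
  · rw [sub_eq_zero.1 h1]
  by_cases h2 : a + b = 0
  · rw [eq_neg_of_add_eq_zero_left h2]
    ext (i | i) <;> simp [word, Matrix.mulVec_neg]
  have := hA.card_zeros_word_le h1
  have := hA.card_zeros_word_le h2
  simp only [Fintype.card_sum, Fintype.card_fin] at hcount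
  omega

/-! ### Hyperplane sections as zero sets of codewords -/

section Points

variable {W : Type*} [AddCommGroup W] [Module (ZMod 3) W]

theorem isCoatom_iff_exists_eq_ker {H : Submodule (ZMod 3) W} :
    IsCoatom H ↔ ∃ φ : Module.Dual (ZMod 3) W, φ ≠ 0 ∧ H = LinearMap.ker φ := by
  constructor
  · intro hH
    obtain ⟨φ, hφ, hle⟩ := H.exists_le_ker_of_lt_top hH.lt_top
    refine ⟨φ, hφ, (hH.le_iff.1 hle).resolve_left (fun h => hφ (LinearMap.ker_eq_top.1 h)) |>.symm⟩
  · rintro ⟨φ, hφ, rfl⟩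
    exact LinearMap.isCoatom_ker_of_surjective (LinearMap.surjective hφ)

/-- The points spanned by a family of vectors. -/
def point {ι : Type*} (v : ι → W) (hv : ∀ i, v i ≠ 0) (i : ι) : ℙ (ZMod 3) W :=
  Projectivization.mk (ZMod 3) (v i) (hv i)

variable {ι : Type*} {v : ι → W} {hv : ∀ i, v i ≠ 0}

theorem point_mem_pointsOf {H : Submodule (ZMod 3) W} {i : ι} :
    point v hv i ∈ pointsOf H ↔ v i ∈ H := by
  simp [point, pointsOf, Projectivization.submodule_mk]

theorem range_point_eq {κ : Type*} {w : κ → W} {hw : ∀ i, w i ≠ 0} (e : κ ≃ ι)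
    (h : ∀ i, ∃ t : ZMod 3, t • w i = v (e i)) :
    Set.range (point v hv) = Set.range (point w hw) := by
  rw [← e.surjective.range_comp]
  congr 1
  ext i
  exact (Projectivization.mk_eq_mk_iff' ..).2 (h i)

theorem blocks_range_point [Fintype ι] (hinj : Function.Injective (point v hv)) :
    blocks (Set.range (point v hv)) =
      {b | ∃ φ : Module.Dual (ZMod 3) W, φ ≠ 0 ∧ 3 < (zeros (φ ∘ v)).card ∧
        b = point v hv '' zeros (φ ∘ v)} := by
  have h : ∀ φ : Module.Dual (ZMod 3) W,
      Set.range (point v hv) ∩ pointsOf (LinearMap.ker φ) = point v hv '' zeros (φ ∘ v) := by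
    intro φ
    rw [Set.inter_comm, ← Set.image_preimage_eq_inter_range]
    congr 1
    ext i
    simp [point_mem_pointsOf]
  ext b
  simp only [blocks, isCoatom_iff_exists_eq_ker, Set.mem_ofPred_eq]
  constructor
  · rintro ⟨⟨_, ⟨φ, hφ, rfl⟩, rfl⟩, h3⟩
    rw [h, hinj.encard_image, Set.encard_coe_eq_coe_finsetCard] at h3
    exact ⟨φ, hφ, by exact_mod_cast h3, h φ⟩
  · rintro ⟨φ, hφ, h3, rfl⟩
    refine ⟨⟨_, ⟨φ, hφ, rfl⟩, (h φ).symm⟩, ?_⟩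
    rw [hinj.encard_image, Set.encard_coe_eq_coe_finsetCard]
    exact_mod_cast h3

/-- The rows of the matrix `A` stacked below the identity matrix. -/
def row (A : Matrix (Fin 6) (Fin 6) (ZMod 3)) : Fin 6 ⊕ Fin 6 → Fin 6 → ZMod 3 :=
  Sum.elim (fun i => Pi.single i 1) A

@[simp]
theorem row_inl (A : Matrix (Fin 6) (Fin 6) (ZMod 3)) (i : Fin 6) :
    row A (Sum.inl i) = Pi.single i 1 := rfl

@[simp]
theorem row_inr (A : Matrix (Fin 6) (Fin 6) (ZMod 3)) (k : Fin 6) : row A (Sum.inr k) = A k := rfl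

/-- The twelve vectors with coordinates `row A` in the basis `b`. -/
def vec (b : Module.Basis (Fin 6) (ZMod 3) W) (A : Matrix (Fin 6) (Fin 6) (ZMod 3))
    (x : Fin 6 ⊕ Fin 6) : W :=
  b.equivFun.symm (row A x)

variable (b : Module.Basis (Fin 6) (ZMod 3) W) {A : Matrix (Fin 6) (Fin 6) (ZMod 3)}

@[simp]
theorem vec_inl (i : Fin 6) : vec b A (Sum.inl i) = b i := by
  rw [vec, LinearEquiv.symm_apply_eq]
  ext j
  simp [Pi.single_apply, eq_comm]

theorem vec_inr (k : Fin 6) : vec b A (Sum.inr k) = ∑ j, A k j • b j := by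
  simp [vec, Module.Basis.equivFun_symm_apply]

theorem comp_vec (φ : Module.Dual (ZMod 3) W) : φ ∘ vec b A = word A (φ ∘ b) := by
  ext (i | k)
  · simp [word]
  · simp [word, vec_inr, Matrix.mulVec, dotProduct]

theorem exists_dual_comp_eq (a : Fin 6 → ZMod 3) :
    ∃ φ : Module.Dual (ZMod 3) W, φ ∘ b = a :=
  ⟨b.constr (ZMod 3) a, funext fun i => by simp⟩

theorem dual_comp_basis_eq_zero {φ : Module.Dual (ZMod 3) W} : φ ∘ b = 0 ↔ φ = 0 := by
  refine ⟨fun h => b.ext fun i => by simpa using congrFun h i, ?_⟩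
  rintro rfl
  rfl

theorem blocks_range_vec {hv : ∀ x, vec b A x ≠ 0}
    (hinj : Function.Injective (point (vec b A) hv)) :
    blocks (Set.range (point (vec b A) hv)) =
      {B | ∃ a : Fin 6 → ZMod 3, a ≠ 0 ∧ 3 < (zeros (word A a)).card ∧
        B = point (vec b A) hv '' zeros (word A a)} := by
  rw [blocks_range_point hinj]
  ext B
  simp only [comp_vec, Set.mem_ofPred_eq]
  constructor
  · rintro ⟨φ, hφ, h⟩
    exact ⟨φ ∘ b, by rwa [Ne, dual_comp_basis_eq_zero], h⟩
  · rintro ⟨a, ha, h⟩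
    obtain ⟨φ, rfl⟩ := exists_dual_comp_eq b a
    exact ⟨φ, by rwa [Ne, ← dual_comp_basis_eq_zero b], h⟩

theorem isExtremal_of_isDesign {hv : ∀ x, vec b A x ≠ 0}
    (hinj : Function.Injective (point (vec b A) hv))
    (h : IsDesign 5 12 6 1 (Set.range (point (vec b A) hv))
      (blocks (Set.range (point (vec b A) hv)))) : IsExtremal A := by
  intro a ha h3
  have := h.card_block _ (by rw [blocks_range_vec b hinj]; exact ⟨a, ha, h3, rfl⟩)
  rw [hinj.encard_image, Set.encard_coe_eq_coe_finsetCard] at this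
  exact_mod_cast this

/-- Five vectors span a proper subspace in dimension six, which gives a block through five points;
`IsExtremal.zeros_word_eq` makes it unique. -/
theorem isDesign_of_isExtremal {hv : ∀ x, vec b A x ≠ 0}
    (hinj : Function.Injective (point (vec b A) hv)) (hA : IsExtremal A) :
    IsDesign 5 12 6 1 (Set.range (point (vec b A) hv))
      (blocks (Set.range (point (vec b A) hv))) := by
  rw [blocks_range_vec b hinj]
  refine ⟨?_, ?_, ?_, ?_⟩
  · rw [← Set.image_univ, hinj.encard_image, Set.encard_univ]
    simp
  · rintro _ ⟨a, -, -, rfl⟩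
    exact Set.image_subset_range _ _
  · rintro _ ⟨a, ha, h3, rfl⟩
    rw [hinj.encard_image, Set.encard_coe_eq_coe_finsetCard, hA a ha h3]
  · intro S hS hS5
    obtain ⟨T, rfl⟩ := Set.subset_range_iff_exists_image_eq.1 hS
    lift T to Finset (Fin 6 ⊕ Fin 6) using Set.toFinite T
    rw [hinj.encard_image, Set.encard_coe_eq_coe_finsetCard] at hS5
    have hT : T.card = 5 := by exact_mod_cast hS5
    classical
    have hlt : Submodule.span (ZMod 3) (T.image (vec b A) : Set W) < ⊤ := by
      have := b.finiteDimensional_of_finite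
      refine lt_top_iff_ne_top.2 fun h => ?_
      have h1 := finrank_span_finset_le_card (R := ZMod 3) (T.image (vec b A))
      rw [Set.finrank, h, finrank_top, Module.finrank_eq_card_basis b, Fintype.card_fin] at h1
      have := Finset.card_image_le (s := T) (f := vec b A)
      omega
    obtain ⟨φ, hφ, hle⟩ := Submodule.exists_le_ker_of_lt_top _ hlt
    have hTφ : T ⊆ zeros (word A (φ ∘ b)) := fun x hx => by
      rw [← comp_vec, mem_zeros]
      exact hle (Submodule.subset_span (by exact_mod_cast Finset.mem_image_of_mem _ hx))
    have hφ0 : φ ∘ b ≠ 0 := by rwa [Ne, dual_comp_basis_eq_zero]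
    have hφ3 := Finset.card_le_card hTφ
    rw [Nat.cast_one, Set.encard_eq_one]
    refine ⟨point (vec b A) hv '' zeros (word A (φ ∘ b)), Set.eq_singleton_iff_unique_mem.2
      ⟨⟨⟨_, hφ0, by omega, rfl⟩, Set.image_mono (by exact_mod_cast hTφ)⟩, ?_⟩⟩
    rintro _ ⟨⟨a, ha, h3, rfl⟩, hTa⟩
    rw [Set.image_subset_image_iff hinj, Finset.coe_subset] at hTa
    have := Finset.card_le_card (Finset.subset_inter hTa hTφ)
    rw [hA.zeros_word_eq ha hφ0 (by omega)]

/-! ### The normal form of the point models -/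

theorem vec_conf_ne_zero (x : Fin 6 ⊕ Fin 6) : vec b conf x ≠ 0 := by
  rw [vec, Ne, LinearEquiv.map_eq_zero_iff]
  revert x
  decide

theorem point_vec_conf_injective :
    Function.Injective (point (vec b conf) (vec_conf_ne_zero b)) := by
  intro x y h
  obtain ⟨t, ht⟩ := (Projectivization.mk_eq_mk_iff' ..).1 h
  rw [vec, vec, ← map_smul, b.equivFun.symm.injective.eq_iff] at ht
  clear h
  revert x y t
  decide +kernel

/-- The set of points which is the normal form of the point models of Witt's design. -/
def golaySet : Set (ℙ (ZMod 3) W) :=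
  Set.range (point (vec b conf) (vec_conf_ne_zero b))

theorem isDesign_golaySet : IsDesign 5 12 6 1 (golaySet b) (blocks (golaySet b)) :=
  isDesign_of_isExtremal b (point_vec_conf_injective b) isExtremal_conf

theorem projectivelyEquivalent_golaySet (b b' : Module.Basis (Fin 6) (ZMod 3) W) :
    ProjectivelyEquivalent (golaySet b) (golaySet b') := by
  refine ⟨b.equiv b' (Equiv.refl _), ?_⟩
  rw [golaySet, golaySet, ← Set.range_comp]
  congr 1
  ext x
  simp only [Function.comp_apply, point, Projectivization.map_mk]
  congr 1
  rcases x with i | k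
  · simp
  · simp [vec_inr]

/-- Otherwise some hyperplane contains all of `K`, and `K` is a block with twelve points instead of
six. -/
theorem span_rep_eq_top {K : Set (ℙ (ZMod 3) W)} (h : IsDesign 5 12 6 1 K (blocks K)) :
    Submodule.span (ZMod 3) (Set.range fun p : K => p.1.rep) = ⊤ := by
  by_contra hne
  obtain ⟨φ, hφ, hle⟩ := Submodule.exists_le_ker_of_lt_top _ (lt_top_iff_ne_top.2 hne)
  have hK : K ∩ pointsOf (LinearMap.ker φ) = K := by
    refine Set.inter_eq_left.2 fun p hp => ?_
    rw [pointsOf, Set.mem_ofPred_eq, Projectivization.submodule_eq,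
      Submodule.span_singleton_le_iff_mem]
    exact hle (Submodule.subset_span ⟨⟨p, hp⟩, rfl⟩)
  have := h.card_block K ⟨⟨_, isCoatom_iff_exists_eq_ker.2 ⟨φ, hφ, rfl⟩, hK.symm⟩, by
    rw [h.card_points]; norm_num⟩
  rw [h.card_points] at this
  norm_num at this

/-- Every point model is the union of the points of a basis and six further points. -/
theorem exists_eq_range_point_vec (hW : Module.finrank (ZMod 3) W = 6) {K : Set (ℙ (ZMod 3) W)}
    (h : IsDesign 5 12 6 1 K (blocks K)) :
    ∃ (b : Module.Basis (Fin 6) (ZMod 3) W) (A : Matrix (Fin 6) (Fin 6) (ZMod 3))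
      (hv : ∀ x, vec b A x ≠ 0), Function.Injective (point (vec b A) hv) ∧
        K = Set.range (point (vec b A) hv) := by
  have hfin : Finite K := Set.finite_of_encard_eq_coe h.card_points
  have hcard : Nat.card K = 12 := by
    have := h.card_points
    rw [Set.encard, ENat.card_eq_coe_natCard] at this
    exact_mod_cast this
  obtain ⟨κ, f, hf, hspan, hli⟩ :=
    exists_linearIndependent' (ZMod 3) fun p : K => p.1.rep
  rw [span_rep_eq_top h] at hspan
  let b₀ := Module.Basis.mk hli hspan.ge
  have hκ : Nat.card κ = 6 := by rw [← Module.finrank_eq_nat_card_basis b₀, hW]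
  have : Finite κ := Nat.finite_of_card_ne_zero (by omega)
  let e : κ ≃ Fin 6 := Finite.equivFinOfCardEq hκ
  let b := b₀.reindex e
  have hc : Nat.card ((Set.range f)ᶜ : Set K) = 6 := by
    have h1 := Set.ncard_add_ncard_compl (Set.range f)
    rw [hcard, ← Set.image_univ, Set.ncard_image_of_injective _ hf, Set.ncard_univ, hκ,
      Set.image_univ] at h1
    rw [Nat.card_coe_set_eq]
    omega
  let q : ((Set.range f)ᶜ : Set K) ≃ Fin 6 := Finite.equivFinOfCardEq hc
  let P : Fin 6 ⊕ Fin 6 → K := Sum.elim (f ∘ e.symm) (fun k => (q.symm k).1)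
  have hP : Function.Injective P := by
    refine Function.Injective.sumElim (hf.comp e.symm.injective)
      (Subtype.val_injective.comp q.symm.injective) fun i k hik => ?_
    exact (q.symm k).2 ⟨_, hik⟩
  have hPs : Function.Surjective P := by
    intro p
    by_cases hp : p ∈ Set.range f
    · obtain ⟨x, rfl⟩ := hp
      exact ⟨Sum.inl (e x), by simp [P]⟩
    · exact ⟨Sum.inr (q ⟨p, hp⟩), by simp [P]⟩
  let A : Matrix (Fin 6) (Fin 6) (ZMod 3) := fun k => b.equivFun (P (Sum.inr k)).1.rep
  have hvec : ∀ x, vec b A x = (P x).1.rep := by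
    rintro (i | k)
    · simp [b, b₀, P]
    · rw [vec, LinearEquiv.symm_apply_eq]
      rfl
  have hv : ∀ x, vec b A x ≠ 0 := fun x => by
    rw [hvec]
    exact Projectivization.rep_nonzero _
  have hpt : point (vec b A) hv = Subtype.val ∘ P := by
    ext x
    simp [point, hvec]
  refine ⟨b, A, hv, ?_, ?_⟩
  · rw [hpt]
    exact Subtype.val_injective.comp hP
  · rw [hpt, hPs.range_comp, Subtype.range_coe]

/-- Every point model has the normal form. -/
theorem exists_eq_golaySet (hW : Module.finrank (ZMod 3) W = 6) {K : Set (ℙ (ZMod 3) W)}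
    (h : IsDesign 5 12 6 1 K (blocks K)) :
    ∃ b : Module.Basis (Fin 6) (ZMod 3) W, K = golaySet b := by
  obtain ⟨b, A, hv, hinj, rfl⟩ := exists_eq_range_point_vec hW h
  obtain ⟨σ, τ, s, t, hs, ht, hA⟩ := (isExtremal_of_isDesign b hinj h).exists_eq_conf
  -- Column permutation and column signs are absorbed by the basis; row permutation and row signs
  -- only relabel and rescale the other six points.
  let b' := (b.reindex τ.symm).isUnitSMul fun j => (ht j).isUnit
  have hb' : ∀ j, b' j = t j • b (τ j) := fun j => by simp [b', Module.Basis.isUnitSMul_apply]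
  refine ⟨b', range_point_eq (Equiv.sumCongr τ σ) ?_⟩
  rintro (j | k)
  · refine ⟨t j, ?_⟩
    simp [hb', smul_smul, mul_self_eq_one (ht j)]
  · refine ⟨s k, ?_⟩
    simp only [vec_inr, Equiv.sumCongr_apply, Sum.map_inr]
    rw [← Equiv.sum_comp τ fun j => A (σ k) j • b j, Finset.smul_sum]
    refine Finset.sum_congr rfl fun j _ => ?_
    rw [hb', hA, smul_smul, smul_smul]
    ring_nf

end Points

/-! ### Witt's design on the projective line over `GF(11)` -/

/-- The matrix `(a b; c d)` takes the point with homogeneous coordinates `y` of the projective line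
into the base block. -/
def MapsToBase (a b c d : ZMod 11) (y : ZMod 11 × ZMod 11) : Prop :=
  c * y.1 + d * y.2 = 0 ∨
    (a * y.1 + b * y.2) * (c * y.1 + d * y.2) ∈ ({1, 3, 4, 5, 9} : Finset (ZMod 11))

instance (a b c d : ZMod 11) (y : ZMod 11 × ZMod 11) : Decidable (MapsToBase a b c d y) :=
  inferInstanceAs (Decidable (_ ∨ _))

/-- Homogeneous coordinates on the projective line. -/
def homCoords (y : OnePoint (ZMod 11)) : ZMod 11 × ZMod 11 :=
  y.elim (1, 0) fun t => (t, 1)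

@[simp]
theorem homCoords_infty : homCoords OnePoint.infty = (1, 0) := rfl

@[simp]
theorem homCoords_coe (t : ZMod 11) : homCoords t = (t, 1) := rfl

theorem infty_mem_baseBlock : OnePoint.infty ∈ baseBlock := Set.mem_insert _ _

theorem coe_mem_baseBlock {t : ZMod 11} :
    (t : OnePoint (ZMod 11)) ∈ baseBlock ↔ t ∈ ({1, 3, 4, 5, 9} : Finset (ZMod 11)) := by
  simp [baseBlock]

/-- The elements n/m and nm differ by the square factor m². -/
theorem div_mem_squares_iff : ∀ n m : ZMod 11, m ≠ 0 →
    (n / m ∈ ({1, 3, 4, 5, 9} : Finset (ZMod 11)) ↔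
      n * m ∈ ({1, 3, 4, 5, 9} : Finset (ZMod 11))) := by
  have h : ∀ k m : ZMod 11, m ≠ 0 → (k ∈ ({1, 3, 4, 5, 9} : Finset (ZMod 11)) ↔
      k * m * m ∈ ({1, 3, 4, 5, 9} : Finset (ZMod 11))) := by
    decide +kernel
  intro n m hm
  rw [h (n / m) m hm, div_mul_cancel₀ n hm]

theorem smul_mem_baseBlock (g : Matrix.SpecialLinearGroup (Fin 2) (ZMod 11))
    (y : OnePoint (ZMod 11)) :
    (g : Matrix.GeneralLinearGroup (Fin 2) (ZMod 11)) • y ∈ baseBlock ↔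
      MapsToBase (g 0 0) (g 0 1) (g 1 0) (g 1 1) (homCoords y) := by
  induction y using OnePoint.rec with
  | infty =>
    rw [OnePoint.smul_infty_eq_ite]
    by_cases h : g 1 0 = 0
    · simp [h, infty_mem_baseBlock, MapsToBase]
    · simp only [Matrix.SpecialLinearGroup.coe_GL_coe_matrix, h, if_false,
        coe_mem_baseBlock, div_mem_squares_iff _ _ h]
      simp [MapsToBase, h]
  | coe t =>
    rw [OnePoint.smul_some_eq_ite]
    by_cases h : g 1 0 * t + g 1 1 = 0
    · simp [h, infty_mem_baseBlock, MapsToBase]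
    · simp only [Matrix.SpecialLinearGroup.coe_GL_coe_matrix, h, if_false,
        coe_mem_baseBlock, div_mem_squares_iff _ _ h]
      simp [MapsToBase, h]

/-- The image of the base block under g is its preimage under g⁻¹. -/
theorem mem_wittBlocks {B : Set (OnePoint (ZMod 11))} :
    B ∈ wittBlocks ↔ ∃ g : Matrix.SpecialLinearGroup (Fin 2) (ZMod 11),
      B = {y | MapsToBase (g 0 0) (g 0 1) (g 1 0) (g 1 1) (homCoords y)} := by
  have h : ∀ g : Matrix.SpecialLinearGroup (Fin 2) (ZMod 11),
      (fun x : OnePoint (ZMod 11) => (g : Matrix.GeneralLinearGroup (Fin 2) (ZMod 11)) • x) ''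
        baseBlock = {y | MapsToBase (g⁻¹ 0 0) (g⁻¹ 0 1) (g⁻¹ 1 0) (g⁻¹ 1 1) (homCoords y)} := by
    intro g
    ext y
    rw [Set.mem_ofPred_eq, ← smul_mem_baseBlock, map_inv]
    exact Set.mem_smul_set_iff_inv_smul_mem
  constructor
  · rintro ⟨g, rfl⟩
    exact ⟨g⁻¹, h g⟩
  · rintro ⟨g, rfl⟩
    exact ⟨g⁻¹, by simpa using h g⁻¹⟩

theorem homCoords_injective : Function.Injective homCoords := by
  intro y z h
  induction y using OnePoint.rec <;> induction z using OnePoint.rec <;> simp_all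

/-- A labelling of the twelve points of the normal form by the points of the projective line. -/
def label : Fin 6 ⊕ Fin 6 → OnePoint (ZMod 11) :=
  Sum.elim ![some 0, some 1, some 2, some 3, some 4, some 5]
    ![some 10, some 6, some 8, some 7, none, some 9]

theorem label_bijective : Function.Bijective label := by
  constructor
  · have h : ∀ x y, homCoords (label x) = homCoords (label y) → x = y := by decide +kernel
    exact fun x y hxy => h x y (congrArg _ hxy)
  · intro y
    induction y using OnePoint.rec with
    | infty => exact ⟨.inr 4, rfl⟩
    | coe t =>
      have h : ∀ t : ZMod 11, ∃ x, homCoords (label x) = (t, 1) := by decide +kernel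
      exact (h t).imp fun x hx => homCoords_injective hx

set_option maxRecDepth 100000 in
-- The maps x ↦ c²x preserve the base block, so each block is given by a matrix with lower row (1,
-- q) or by a translation. That leaves 121 + 11 = 132 candidates to search.
theorem exists_mapsToBase : ∀ a : Fin 6 → ZMod 3, 3 < (zeros (word conf a)).card → a ≠ 0 →
    (∃ p q : ZMod 11,
      ∀ x, word conf a x = 0 ↔ MapsToBase p (p * q - 1) 1 q (homCoords (label x))) ∨
    ∃ p : ZMod 11, ∀ x, word conf a x = 0 ↔ MapsToBase 1 p 0 1 (homCoords (label x)) := by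
  rw [forall_fin_six_iff]
  simp only [word_conf]
  decide +kernel

theorem image_label_mem_wittBlocks {a : Fin 6 → ZMod 3} (ha : a ≠ 0)
    (h3 : 3 < (zeros (word conf a)).card) : label '' zeros (word conf a) ∈ wittBlocks := by
  have key : ∀ g : Matrix.SpecialLinearGroup (Fin 2) (ZMod 11),
      (∀ x, word conf a x = 0 ↔
        MapsToBase (g 0 0) (g 0 1) (g 1 0) (g 1 1) (homCoords (label x))) →
      label '' zeros (word conf a) ∈ wittBlocks := fun g hg => by
    refine mem_wittBlocks.2 ⟨g, ?_⟩
    ext y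
    obtain ⟨x, rfl⟩ := label_bijective.surjective y
    rw [label_bijective.injective.mem_set_image, Finset.mem_coe, mem_zeros, hg, Set.mem_ofPred_eq]
  rcases exists_mapsToBase a h3 ha with ⟨p, q, h⟩ | ⟨p, h⟩
  · exact key ⟨!![p, p * q - 1; 1, q], by simp [Matrix.det_fin_two]⟩ (by simpa using h)
  · exact key ⟨!![1, p; 0, 1], by simp [Matrix.det_fin_two]⟩ (by simpa using h)

/-- The matrix is multiplied from the left by diag(c, 1/c), which acts as x ↦ c²x and preserves the
base block. -/
theorem mapsToBase_iff_of_ne_zero {a b c d : ZMod 11} (h : a * d - b * c = 1) (hc : c ≠ 0)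
    (y : ZMod 11 × ZMod 11) :
    MapsToBase a b c d y ↔ MapsToBase (a * c) (a * c * (d / c) - 1) 1 (d / c) y := by
  have h1 : c * y.1 + d * y.2 = c * (1 * y.1 + d / c * y.2) := by field_simp
  have h2 : (a * c * y.1 + (a * c * (d / c) - 1) * y.2) * (1 * y.1 + d / c * y.2) =
      (a * y.1 + b * y.2) * (c * y.1 + d * y.2) := by
    have : a * c * (d / c) - 1 = b * c := by
      field_simp
      linear_combination h
    rw [this, h1]
    ring
  rw [MapsToBase, MapsToBase, h2]
  refine or_congr_left ?_
  rw [h1, mul_eq_zero, or_iff_right hc]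

theorem mapsToBase_zero_iff {a b d : ZMod 11} (h : a * d = 1) (y : ZMod 11 × ZMod 11) :
    MapsToBase a b 0 d y ↔ MapsToBase 1 (b * d) 0 1 y := by
  have hd : d ≠ 0 := right_ne_zero_of_mul_eq_one h
  have h2 : (1 * y.1 + b * d * y.2) * (0 * y.1 + 1 * y.2) =
      (a * y.1 + b * y.2) * (0 * y.1 + d * y.2) := by
    linear_combination (-y.1 * y.2) * h
  rw [MapsToBase, MapsToBase, h2]
  refine or_congr_left ?_
  simp [hd]

/-- The positions that the matrix `(a b; c d)` takes from the base block into the base block. -/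
def baseInter (a b c d : ZMod 11) : Finset (Fin 6 ⊕ Fin 6) :=
  Finset.univ.filter fun x => MapsToBase 1 0 0 1 (homCoords (label x)) ∧
    MapsToBase a b c d (homCoords (label x))

theorem mapsToBase_iff_of_card_baseInter (g : Matrix.SpecialLinearGroup (Fin 2) (ZMod 11))
    (h : 5 ≤ (baseInter (g 0 0) (g 0 1) (g 1 0) (g 1 1)).card) (x : Fin 6 ⊕ Fin 6) :
    MapsToBase 1 0 0 1 (homCoords (label x)) ↔
      MapsToBase (g 0 0) (g 0 1) (g 1 0) (g 1 1) (homCoords (label x)) := by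
  have h₁ : ∀ p q : ZMod 11, 5 ≤ (baseInter p (p * q - 1) 1 q).card → ∀ x,
      MapsToBase 1 0 0 1 (homCoords (label x)) ↔
        MapsToBase p (p * q - 1) 1 q (homCoords (label x)) := by
    decide +kernel
  have h₀ : ∀ p : ZMod 11, 5 ≤ (baseInter 1 p 0 1).card → ∀ x,
      MapsToBase 1 0 0 1 (homCoords (label x)) ↔
        MapsToBase 1 p 0 1 (homCoords (label x)) := by
    decide +kernel
  have hdet : g 0 0 * g 1 1 - g 0 1 * g 1 0 = 1 := by
    rw [← Matrix.det_fin_two]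
    exact g.2
  by_cases hc : g 1 0 = 0
  · rw [hc] at h hdet ⊢
    have hdet' : g 0 0 * g 1 1 = 1 := by simpa using hdet
    simp only [baseInter, mapsToBase_zero_iff hdet'] at h ⊢
    exact h₀ _ h x
  · simp only [baseInter, mapsToBase_iff_of_ne_zero hdet hc] at h ⊢
    exact h₁ _ _ h x

/-- Two blocks of Witt's design with five common points are equal. -/
theorem wittBlocks_eq_of_encard_inter {B C : Set (OnePoint (ZMod 11))} (hB : B ∈ wittBlocks)
    (hC : C ∈ wittBlocks) (h : 5 ≤ (B ∩ C).encard) : B = C := by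
  obtain ⟨g, rfl⟩ := mem_wittBlocks.1 hB
  obtain ⟨k, rfl⟩ := mem_wittBlocks.1 hC
  have hbase : ∀ y, y ∈ baseBlock ↔ MapsToBase 1 0 0 1 (homCoords y) := fun y => by
    simpa using smul_mem_baseBlock 1 y
  have hquot : ∀ y : OnePoint (ZMod 11),
      (k : Matrix.GeneralLinearGroup (Fin 2) (ZMod 11)) • y =
        ((k * g⁻¹ : Matrix.SpecialLinearGroup (Fin 2) (ZMod 11)) :
          Matrix.GeneralLinearGroup (Fin 2) (ZMod 11)) •
            (g : Matrix.GeneralLinearGroup (Fin 2) (ZMod 11)) • y := fun y => by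
    rw [smul_smul, ← map_mul, inv_mul_cancel_right]
  -- Applying `g` turns the first block into the base block and the second into the preimage of the
  -- base block under `m`, so only 132 intersections with the base block need checking.
  set m := k * g⁻¹
  simp only [← smul_mem_baseBlock, hquot] at h ⊢
  have hcard : 5 ≤ (baseInter (m 0 0) (m 0 1) (m 1 0) (m 1 1)).card := by
    have himage : (fun y : OnePoint (ZMod 11) =>
        (g : Matrix.GeneralLinearGroup (Fin 2) (ZMod 11)) • y) ''
        ({y | (g : Matrix.GeneralLinearGroup (Fin 2) (ZMod 11)) • y ∈ baseBlock} ∩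
          {y | (m : Matrix.GeneralLinearGroup (Fin 2) (ZMod 11)) •
            (g : Matrix.GeneralLinearGroup (Fin 2) (ZMod 11)) • y ∈ baseBlock}) ⊆
        label '' baseInter (m 0 0) (m 0 1) (m 1 0) (m 1 1) := by
      rintro _ ⟨y, ⟨h1, h2⟩, rfl⟩
      obtain ⟨x, hx⟩ := label_bijective.surjective
        ((g : Matrix.GeneralLinearGroup (Fin 2) (ZMod 11)) • y)
      rw [Set.mem_ofPred_eq] at h1 h2
      rw [← hx] at h1 h2
      refine ⟨x, ?_, hx⟩
      simpa [baseInter, ← hbase, ← smul_mem_baseBlock] using ⟨h1, h2⟩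
    have := Set.encard_le_encard himage
    rw [(MulAction.injective _).encard_image, label_bijective.injective.encard_image,
      Set.encard_coe_eq_coe_finsetCard] at this
    exact_mod_cast h.trans this
  ext y
  obtain ⟨x, hx⟩ := label_bijective.surjective
    ((g : Matrix.GeneralLinearGroup (Fin 2) (ZMod 11)) • y)
  rw [Set.mem_ofPred_eq, Set.mem_ofPred_eq, ← hx, hbase, smul_mem_baseBlock]
  exact mapsToBase_iff_of_card_baseInter m hcard x

theorem encard_of_mem_wittBlocks {B : Set (OnePoint (ZMod 11))} (hB : B ∈ wittBlocks) :
    B.encard = 6 := by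
  obtain ⟨g, rfl⟩ := hB
  rw [(MulAction.injective _).encard_image, baseBlock, Set.encard_insert_of_notMem (by simp),
    OnePoint.coe_injective.encard_image]
  have : ({1, 3, 4, 5, 9} : Set (ZMod 11)) = (({1, 3, 4, 5, 9} : Finset (ZMod 11)) : Set _) := by
    simp
  rw [this, Set.encard_coe_eq_coe_finsetCard]
  rfl

/-- A bijection that maps the blocks of a `5`-design to elements of a family of six-element sets,
any two of which with five common points are equal, is an isomorphism. -/
theorem IsDesign.image_eq {P Q : Type*} {X : Set P} {B : Set (Set P)} {v k : ℕ} {Y : Set Q}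
    {C : Set (Set Q)} (h : IsDesign 5 v k 1 X B) {f : P → Q} (hf : Set.BijOn f X Y)
    (hBC : ∀ b ∈ B, f '' b ∈ C) (hY : ∀ c ∈ C, c ⊆ Y) (hC : ∀ c ∈ C, 5 ≤ c.encard)
    (hCC : ∀ c ∈ C, ∀ d ∈ C, 5 ≤ (c ∩ d).encard → c = d) : (fun b => f '' b) '' B = C := by
  refine Set.Subset.antisymm (Set.image_subset_iff.2 hBC) fun c hc => ?_
  -- Five points of `c` are pulled back to `X`; the image of the block through them shares these
  -- five points with `c`, hence equals `c`.
  obtain ⟨T, hTc, hT⟩ := Set.exists_subset_encard_eq (hC c hc)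
  obtain ⟨S, hSX, rfl⟩ := Set.subset_image_iff.1 ((hTc.trans (hY c hc)).trans hf.surjOn)
  rw [(hf.injOn.mono hSX).encard_image] at hT
  obtain ⟨b, hb⟩ := Set.encard_eq_one.1 (by simpa using h.card_through S hSX (by simpa using hT))
  obtain ⟨hbB, hSb⟩ : b ∈ B ∧ S ⊆ b := by
    have : b ∈ {b ∈ B | S ⊆ b} := hb ▸ Set.mem_singleton b
    exact this
  refine ⟨b, hbB, hCC _ (hBC b hbB) c hc ?_⟩
  rw [← hT, ← (hf.injOn.mono hSX).encard_image]
  exact Set.encard_le_encard (Set.subset_inter (Set.image_mono hSb) hTc)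

theorem designIso_golaySet {W : Type*} [AddCommGroup W] [Module (ZMod 3) W]
    (b : Module.Basis (Fin 6) (ZMod 3) W) :
    DesignIso (golaySet b) (blocks (golaySet b)) Set.univ wittBlocks := by
  have hinj := point_vec_conf_injective b
  -- `DesignIso` asks for a map on all points; its value `∞` outside `golaySet b` is arbitrary.
  have hext : Function.extend (point (vec b conf) (vec_conf_ne_zero b)) label
      (fun _ => OnePoint.infty) ∘ point (vec b conf) (vec_conf_ne_zero b) = label :=
    Function.extend_comp hinj _ _
  have hf : Set.BijOn (Function.extend (point (vec b conf) (vec_conf_ne_zero b)) label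
      (fun _ => OnePoint.infty)) (golaySet b) Set.univ := by
    refine ⟨Set.mapsTo_univ _ _, ?_, ?_⟩
    · rintro _ ⟨x, rfl⟩ _ ⟨y, rfl⟩ h
      rw [hinj.extend_apply, hinj.extend_apply] at h
      rw [label_bijective.injective h]
    · intro y _
      obtain ⟨x, rfl⟩ := label_bijective.surjective y
      exact ⟨_, ⟨x, rfl⟩, hinj.extend_apply _ _ _⟩
  refine ⟨_, hf, (isDesign_golaySet b).image_eq hf ?_ (fun _ _ => Set.subset_univ _)
    (fun c hc => ?_) fun c hc d hd => wittBlocks_eq_of_encard_inter hc hd⟩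
  · rw [golaySet, blocks_range_vec b hinj]
    rintro _ ⟨a, ha, h3, rfl⟩
    rw [← Set.image_comp, hext]
    exact image_label_mem_wittBlocks ha h3
  · rw [encard_of_mem_wittBlocks hc]
    norm_num

/-! ### Coordinates on the symmetric square -/

section SymmetricSquare

variable {V : Type*} [AddCommGroup V] [Module (ZMod 3) V]

theorem tprod_comm (x y : V) :
    SymmetricPower.tprod (ZMod 3) (ι := Fin 2) ![x, y] =
      SymmetricPower.tprod (ZMod 3) (ι := Fin 2) ![y, x] := by
  rw [← SymmetricPower.tprod_equiv (Equiv.swap 0 1) ![x, y]]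
  congr 1
  ext i
  fin_cases i <;> rfl

/-- The symmetric product of two vectors. -/
def symMul : V →ₗ[ZMod 3] V →ₗ[ZMod 3] Sym[ZMod 3]^2 V :=
  have hadd : ∀ x x' y : V, SymmetricPower.tprod (ZMod 3) (ι := Fin 2) ![x + x', y] =
      SymmetricPower.tprod (ZMod 3) (ι := Fin 2) ![x, y] +
        SymmetricPower.tprod (ZMod 3) (ι := Fin 2) ![x', y] := fun x x' y =>
    (SymmetricPower.tprod (ZMod 3) (ι := Fin 2) (M := V)).cons_add ![y] x x'
  have hsmul : ∀ (c : ZMod 3) (x y : V), SymmetricPower.tprod (ZMod 3) (ι := Fin 2) ![c • x, y] =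
      c • SymmetricPower.tprod (ZMod 3) (ι := Fin 2) ![x, y] := fun c x y =>
    (SymmetricPower.tprod (ZMod 3) (ι := Fin 2) (M := V)).cons_smul ![y] c x
  LinearMap.mk₂ (ZMod 3) (fun x y => SymmetricPower.tprod (ZMod 3) (ι := Fin 2) ![x, y])
    hadd hsmul
    (fun x y y' => by rw [tprod_comm, hadd, tprod_comm y, tprod_comm y'])
    (fun c x y => by rw [tprod_comm, hsmul, tprod_comm y])

theorem symMul_comm (x y : V) : symMul x y = symMul y x := tprod_comm x y

theorem symSq_eq_symMul (x : V) : symSq x = symMul x x := by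
  change SymmetricPower.tprod (ZMod 3) (ι := Fin 2) (fun _ => x) =
    SymmetricPower.tprod (ZMod 3) (ι := Fin 2) ![x, x]
  congr 1
  ext i
  fin_cases i <;> rfl

theorem span_symMul_eq_top :
    Submodule.span (ZMod 3) (Set.range fun p : V × V => symMul p.1 p.2) = ⊤ := by
  rw [← SymmetricPower.span_tprod_eq_top (R := ZMod 3) (ι := Fin 2) (M := V)]
  congr 1
  ext w
  constructor
  · rintro ⟨p, rfl⟩
    exact ⟨![p.1, p.2], rfl⟩
  · rintro ⟨f, rfl⟩
    refine ⟨(f 0, f 1), ?_⟩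
    change SymmetricPower.tprod (ZMod 3) (ι := Fin 2) ![f 0, f 1] = _
    congr 1
    ext i
    fin_cases i <;> rfl

/-- The linear form on the symmetric square given by a product of two linear forms. -/
theorem exists_dual_symMul (f g : Module.Dual (ZMod 3) V) :
    ∃ φ : Module.Dual (ZMod 3) (Sym[ZMod 3]^2 V), ∀ x y,
      φ (symMul x y) = f x * g y + f y * g x := by
  let m : (⨂[ZMod 3] _ : Fin 2, V) →ₗ[ZMod 3] ZMod 3 := PiTensorProduct.lift
    ((MultilinearMap.mkPiAlgebra (ZMod 3) (Fin 2) (ZMod 3)).compLinearMap ![f, g] +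
      (MultilinearMap.mkPiAlgebra (ZMod 3) (Fin 2) (ZMod 3)).compLinearMap ![g, f])
  have hm : addConGen (SymmetricPower.Rel (ZMod 3) (Fin 2) V) ≤ AddCon.ker m.toAddMonoidHom := by
    refine AddCon.addConGen_le.2 ?_
    rintro _ _ ⟨e, v⟩
    have he : e = 1 ∨ e = Equiv.swap 0 1 := by
      revert e
      decide
    rcases he with rfl | rfl
    · rfl
    · simp only [AddCon.ker_rel]
      simp [m, Fin.prod_univ_two]
      ring
  let h : Sym[ZMod 3]^2 V →+ ZMod 3 := AddCon.lift _ m.toAddMonoidHom hm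
  refine ⟨h.toZModLinearMap 3, fun x y => ?_⟩
  change m (PiTensorProduct.tprod (ZMod 3) ![x, y]) = _
  simp [m, Fin.prod_univ_two]
  ring

variable (e : Module.Basis (Fin 3) (ZMod 3) V)

/-- The products of the vectors of a basis. -/
def basisProd : Fin 6 → Sym[ZMod 3]^2 V :=
  ![symMul (e 0) (e 0), symMul (e 1) (e 1), symMul (e 2) (e 2), symMul (e 0) (e 1),
    symMul (e 0) (e 2), symMul (e 1) (e 2)]

/-- The coordinates of the symmetric product of two vectors with coordinates `a` and `b`. -/
def mulCoords (a b : Fin 3 → ZMod 3) : Fin 6 → ZMod 3 :=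
  ![a 0 * b 0, a 1 * b 1, a 2 * b 2, a 0 * b 1 + a 1 * b 0, a 0 * b 2 + a 2 * b 0,
    a 1 * b 2 + a 2 * b 1]

theorem symMul_equivFun_symm (a b : Fin 3 → ZMod 3) :
    symMul (e.equivFun.symm a) (e.equivFun.symm b) = ∑ m, mulCoords a b m • basisProd e m := by
  simp only [Module.Basis.equivFun_symm_apply, Fin.sum_univ_three, Fin.sum_univ_six, map_add,
    map_smul, LinearMap.add_apply, LinearMap.smul_apply, mulCoords, basisProd, Matrix.cons_val]
  rw [symMul_comm (e 1) (e 0), symMul_comm (e 2) (e 0), symMul_comm (e 2) (e 1)]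
  module

theorem span_basisProd_eq_top : ⊤ ≤ Submodule.span (ZMod 3) (Set.range (basisProd e)) := by
  rw [← span_symMul_eq_top, Submodule.span_le]
  rintro _ ⟨⟨x, y⟩, rfl⟩
  obtain ⟨a, rfl⟩ := e.equivFun.symm.surjective x
  obtain ⟨b, rfl⟩ := e.equivFun.symm.surjective y
  rw [SetLike.mem_coe]
  simp only [symMul_equivFun_symm]
  exact Submodule.sum_mem _ fun m _ => Submodule.smul_mem _ _ (Submodule.subset_span ⟨m, rfl⟩)

/-- The symmetrised products of coordinate forms are dual to the products of basis vectors up to the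
factor 2 on the squares, which is invertible in characteristic 3. -/
theorem linearIndependent_basisProd : LinearIndependent (ZMod 3) (basisProd e) := by
  rw [Fintype.linearIndependent_iff]
  intro c hc
  have h : ∀ i j : Fin 3, ∃ φ : Module.Dual (ZMod 3) (Sym[ZMod 3]^2 V), (∀ x y, φ (symMul x y) =
      e.coord i x * e.coord j y + e.coord i y * e.coord j x) ∧
        ∑ m, c m * φ (basisProd e m) = 0 := fun i j => by
    obtain ⟨φ, hφ⟩ := exists_dual_symMul (e.coord i) (e.coord j)
    exact ⟨φ, hφ, by simpa using congrArg φ hc⟩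
  have h2 : ∀ t : ZMod 3, t * (1 + 1) = 0 → t = 0 := by decide
  intro m
  fin_cases m
  · obtain ⟨φ, hφ, h0⟩ := h 0 0
    exact h2 _ (by simpa [Fin.sum_univ_six, basisProd, hφ, Finsupp.single_apply] using h0)
  · obtain ⟨φ, hφ, h0⟩ := h 1 1
    exact h2 _ (by simpa [Fin.sum_univ_six, basisProd, hφ, Finsupp.single_apply] using h0)
  · obtain ⟨φ, hφ, h0⟩ := h 2 2
    exact h2 _ (by simpa [Fin.sum_univ_six, basisProd, hφ, Finsupp.single_apply] using h0)
  · obtain ⟨φ, hφ, h0⟩ := h 0 1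
    simpa [Fin.sum_univ_six, basisProd, hφ, Finsupp.single_apply] using h0
  · obtain ⟨φ, hφ, h0⟩ := h 0 2
    simpa [Fin.sum_univ_six, basisProd, hφ, Finsupp.single_apply] using h0
  · obtain ⟨φ, hφ, h0⟩ := h 1 2
    simpa [Fin.sum_univ_six, basisProd, hφ, Finsupp.single_apply] using h0

/-- The basis of the symmetric square formed by the products of the vectors of a basis. -/
def symBasis : Module.Basis (Fin 6) (ZMod 3) (Sym[ZMod 3]^2 V) :=
  Module.Basis.mk (linearIndependent_basisProd e) (span_basisProd_eq_top e)

theorem symSq_equivFun_symm (a : Fin 3 → ZMod 3) :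
    symSq (e.equivFun.symm a) = (symBasis e).equivFun.symm (mulCoords a a) := by
  rw [symSq_eq_symMul, symMul_equivFun_symm, Module.Basis.equivFun_symm_apply]
  simp [symBasis]

end SymmetricSquare

/-! ### Coordinates of the point model -/

/-- The coordinates of the points of the quadrangle that is replaced. -/
def quad : Fin 4 → Fin 6 → ZMod 3 :=
  ![mulCoords ![1, 0, 0] ![1, 0, 0], mulCoords ![0, 1, 0] ![0, 1, 0],
    mulCoords ![1, 1, 0] ![1, 1, 0], mulCoords ![1, -1, 0] ![1, -1, 0]]

/-- The coordinates of the diagonal points of the quadrangle. -/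
def diag : Fin 3 → Fin 6 → ZMod 3 :=
  ![![1, 1, 0, 0, 0, 0], ![1, -1, 0, 1, 0, 0], ![1, -1, 0, -1, 0, 0]]

/-- The columns are the coordinates of six points of the model. -/
def modelMatrix : Matrix (Fin 6) (Fin 6) (ZMod 3) :=
  !![0, 0, 0, 1, -1, 1;
     0, 1, -1, 0, -1, 1;
     1, 1, -1, 1, -1, 1;
     0, 0, 0, 0, 1, -1;
     0, 0, 0, -1, 1, 1;
     0, -1, -1, 0, 1, 1]

/-- The inverse of `modelMatrix`. -/
def modelMatrixInv : Matrix (Fin 6) (Fin 6) (ZMod 3) :=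
  !![-1, -1, 1, -1, 0, 0;
     -1, -1, 0, 1, -1, 1;
     -1, 1, 0, 0, -1, 1;
     1, 0, 0, 1, 0, 0;
     -1, 0, 0, 1, -1, 0;
     -1, 0, 0, 0, -1, 0]

theorem modelMatrix_mul_inv : modelMatrix * modelMatrixInv = 1 := by decide +kernel

theorem modelMatrixInv_mul : modelMatrixInv * modelMatrix = 1 := by decide +kernel

theorem forall_fin_three_iff {p : (Fin 3 → ZMod 3) → Prop} :
    (∀ a, p a) ↔ ∀ a b c : ZMod 3, p ![a, b, c] := by
  refine ⟨fun h _ _ _ => h _, fun h a => ?_⟩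
  convert! h (a 0) (a 1) (a 2)
  ext i
  fin_cases i <;> rfl

theorem exists_modelMatrix_of_ne_zero : ∀ a : Fin 3 → ZMod 3, a 2 ≠ 0 →
    ∃ x, ∃ t : ZMod 3, t ≠ 0 ∧ mulCoords a a = t • modelMatrix.mulVec (row conf x) := by
  rw [forall_fin_three_iff]
  decide +kernel

theorem exists_modelMatrix_diag : ∀ n,
    ∃ x, ∃ t : ZMod 3, t ≠ 0 ∧ diag n = t • modelMatrix.mulVec (row conf x) := by
  decide +kernel

/-- Up to scalars, the columns of `modelMatrix` and their combinations by the rows of `conf` are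
nine Veronese points off the line and three diagonal points. -/
theorem modelMatrix_row_cases : ∀ x,
    (∃ a b c t : ZMod 3, t ≠ 0 ∧ c ≠ 0 ∧
      modelMatrix.mulVec (row conf x) = t • mulCoords ![a, b, c] ![a, b, c]) ∨
    ∃ n, ∃ t : ZMod 3, t ≠ 0 ∧ modelMatrix.mulVec (row conf x) = t • diag n := by
  decide +kernel

theorem exists_quad : ∀ a : Fin 3 → ZMod 3, a 2 = 0 → a ≠ 0 →
    ∃ i, ∃ t : ZMod 3, t ≠ 0 ∧ mulCoords a a = t • quad i := by
  rw [forall_fin_three_iff]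
  decide +kernel

theorem quad_eq (i : Fin 4) : ∃ a : Fin 3 → ZMod 3, a 2 = 0 ∧ a ≠ 0 ∧ quad i = mulCoords a a := by
  fin_cases i
  · exact ⟨![1, 0, 0], by decide, by decide, rfl⟩
  · exact ⟨![0, 1, 0], by decide, by decide, rfl⟩
  · exact ⟨![1, 1, 0], by decide, by decide, rfl⟩
  · exact ⟨![1, -1, 0], by decide, by decide, rfl⟩

theorem smul_quad_ne : ∀ i j, i ≠ j → ∀ t : ZMod 3, t • quad j ≠ quad i := by
  decide +kernel

theorem eq_smul_diag : ∀ i j k l, i ≠ j → i ≠ k → i ≠ l → j ≠ k → j ≠ l → k ≠ l →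
    ∀ α β γ δ : ZMod 3, α • quad i + β • quad j = γ • quad k + δ • quad l →
      α • quad i + β • quad j ≠ 0 →
        ∃ n, ∃ t : ZMod 3, t ≠ 0 ∧ α • quad i + β • quad j = t • diag n := by
  decide +kernel

theorem diag_eq : ∀ n, ∃ i j k l, i ≠ j ∧ i ≠ k ∧ i ≠ l ∧ j ≠ k ∧ j ≠ l ∧ k ≠ l ∧
    (∀ m, m = i ∨ m = j ∨ m = k ∨ m = l) ∧
      (∃ α β : ZMod 3, α • quad i + β • quad j = diag n) ∧
        ∃ γ δ : ZMod 3, γ • quad k + δ • quad l = diag n := by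
  decide +kernel

theorem diag_ne_zero : ∀ n, diag n ≠ 0 := by decide +kernel

theorem quad_ne_zero : ∀ n, quad n ≠ 0 := by decide +kernel

theorem mulCoords_ne_zero : ∀ a : Fin 3 → ZMod 3, a ≠ 0 → mulCoords a a ≠ 0 := by
  rw [forall_fin_three_iff]
  decide +kernel

/-! ### The quadrangle, its diagonal triangle and the model in coordinates -/

section Model

variable {V : Type*} [AddCommGroup V] [Module (ZMod 3) V]

/-- The point with given non-zero coordinates. -/
def pt {W : Type*} [AddCommGroup W] [Module (ZMod 3) W] {ι : Type*} [Finite ι]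
    (b : Module.Basis ι (ZMod 3) W) (c : ι → ZMod 3) (hc : c ≠ 0) : ℙ (ZMod 3) W :=
  Projectivization.mk (ZMod 3) (b.equivFun.symm c) (by simpa using hc)

section pt

variable {W : Type*} [AddCommGroup W] [Module (ZMod 3) W] {ι : Type*} [Finite ι]
  (b : Module.Basis ι (ZMod 3) W)

theorem exists_eq_pt (p : ℙ (ZMod 3) W) : ∃ c hc, p = pt b c hc := by
  induction p using Projectivization.ind with
  | h v hv => exact ⟨b.equivFun v, by simpa using hv,
      by simp only [pt, LinearEquiv.symm_apply_apply]⟩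

theorem pt_eq_pt_iff {c d : ι → ZMod 3} {hc : c ≠ 0} {hd : d ≠ 0} :
    pt b c hc = pt b d hd ↔ ∃ t : ZMod 3, t • d = c := by
  rw [pt, pt, Projectivization.mk_eq_mk_iff']
  simp only [← map_smul, b.equivFun.symm.injective.eq_iff]

theorem pt_eq_pt_of_eq_smul {c d : ι → ZMod 3} {hc : c ≠ 0} {hd : d ≠ 0} {t : ZMod 3}
    (h : c = t • d) : pt b c hc = pt b d hd :=
  (pt_eq_pt_iff b).2 ⟨t, h.symm⟩

theorem pt_submodule_le_sup {c d d' : ι → ZMod 3} {hc : c ≠ 0} {hd : d ≠ 0} {hd' : d' ≠ 0} :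
    (pt b c hc).submodule ≤ (pt b d hd).submodule ⊔ (pt b d' hd').submodule ↔
      ∃ α β : ZMod 3, α • d + β • d' = c := by
  simp only [pt, Projectivization.submodule_mk, Submodule.span_singleton_le_iff_mem,
    Submodule.mem_sup, Submodule.mem_span_singleton, exists_exists_eq_and, ← map_smul, ← map_add,
    b.equivFun.symm.injective.eq_iff]

end pt

variable (e : Module.Basis (Fin 3) (ZMod 3) V)

theorem veronese_pt {a : Fin 3 → ZMod 3} (ha : a ≠ 0) :
    veronese (pt e a ha) = pt (symBasis e) (mulCoords a a) (mulCoords_ne_zero a ha) := by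
  simp only [pt, veronese, Projectivization.lift_mk, symSq_equivFun_symm]

variable {e} {L : Submodule (ZMod 3) V}

theorem pt_mem_pointsOf (hL : ∀ v, v ∈ L ↔ e.equivFun v 2 = 0)
    {a : Fin 3 → ZMod 3} {ha : a ≠ 0} :
    pt e a ha ∈ pointsOf L ↔ a 2 = 0 := by
  rw [pt, pointsOf, Set.mem_ofPred_eq, Projectivization.submodule_mk,
    Submodule.span_singleton_le_iff_mem, hL, LinearEquiv.apply_symm_apply]

theorem veronese_image_eq (hL : ∀ v, v ∈ L ↔ e.equivFun v 2 = 0) :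
    veronese '' pointsOf L =
    Set.range fun i => pt (symBasis e) (quad i) (quad_ne_zero i) := by
  ext q
  constructor
  · rintro ⟨p, hp, rfl⟩
    obtain ⟨a, ha, rfl⟩ := exists_eq_pt e p
    obtain ⟨i, t, -, h⟩ := exists_quad a ((pt_mem_pointsOf hL).1 hp) ha
    rw [veronese_pt]
    exact ⟨i, (pt_eq_pt_of_eq_smul _ h).symm⟩
  · rintro ⟨i, rfl⟩
    obtain ⟨a, h2, ha, h⟩ := quad_eq i
    exact ⟨pt e a ha, (pt_mem_pointsOf hL).2 h2, by simp only [veronese_pt, h]⟩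

theorem mem_veronese_diff (hL : ∀ v, v ∈ L ↔ e.equivFun v 2 = 0)
    {q : ℙ (ZMod 3) (Sym[ZMod 3]^2 V)} :
    q ∈ Set.range veronese \ (veronese '' pointsOf L) ↔
      ∃ a ha, a 2 ≠ 0 ∧ q = pt (symBasis e) (mulCoords a a) (mulCoords_ne_zero a ha) := by
  constructor
  · rintro ⟨⟨p, rfl⟩, hp⟩
    obtain ⟨a, ha, rfl⟩ := exists_eq_pt e p
    exact ⟨a, ha, fun h => hp ⟨_, (pt_mem_pointsOf hL).2 h, rfl⟩, veronese_pt e ha⟩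
  · rintro ⟨a, ha, h2, rfl⟩
    refine ⟨⟨pt e a ha, veronese_pt e ha⟩, ?_⟩
    rintro ⟨p, hp, h⟩
    obtain ⟨a', ha', rfl⟩ := exists_eq_pt e p
    have h2' : a' 2 = 0 := (pt_mem_pointsOf hL).1 hp
    rw [veronese_pt] at h
    obtain ⟨t, ht⟩ := (pt_eq_pt_iff _).1 h.symm
    -- The coordinate of index 2 of `mulCoords a a` is (a 2)², which vanishes exactly for points of
    -- the line.
    have := congrFun ht 2
    simp only [mulCoords, Pi.smul_apply, Matrix.cons_val, h2', mul_zero, smul_zero] at this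
    exact h2 (mul_self_eq_zero.1 this.symm)

theorem diagonalPoints_eq (hL : ∀ v, v ∈ L ↔ e.equivFun v 2 = 0) :
    diagonalPoints (veronese '' pointsOf L) =
    Set.range fun n => pt (symBasis e) (diag n) (diag_ne_zero n) := by
  have hinj : Function.Injective fun i => pt (symBasis e) (quad i) (quad_ne_zero i) := by
    intro i j h
    by_contra hij
    obtain ⟨t, ht⟩ := (pt_eq_pt_iff _).1 h
    exact smul_quad_ne i j hij t ht
  rw [veronese_image_eq hL]
  ext q
  constructor
  · rintro ⟨a, b, c, d, hab, hac, had, hbc, hbd, hcd, hG, h1, h2⟩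
    obtain ⟨i, rfl⟩ := hG.ge (show a ∈ _ by simp)
    obtain ⟨j, rfl⟩ := hG.ge (show b ∈ _ by simp)
    obtain ⟨k, rfl⟩ := hG.ge (show c ∈ _ by simp)
    obtain ⟨l, rfl⟩ := hG.ge (show d ∈ _ by simp)
    obtain ⟨x, hx, rfl⟩ := exists_eq_pt (symBasis e) q
    obtain ⟨α, β, rfl⟩ := (pt_submodule_le_sup _).1 h1
    obtain ⟨γ, δ, h⟩ := (pt_submodule_le_sup _).1 h2
    obtain ⟨n, t, -, hn⟩ := eq_smul_diag i j k l (by rintro rfl; exact hab rfl)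
      (by rintro rfl; exact hac rfl) (by rintro rfl; exact had rfl) (by rintro rfl; exact hbc rfl)
      (by rintro rfl; exact hbd rfl) (by rintro rfl; exact hcd rfl) α β γ δ h.symm hx
    exact ⟨n, (pt_eq_pt_of_eq_smul _ hn).symm⟩
  · rintro ⟨n, rfl⟩
    obtain ⟨i, j, k, l, hij, hik, hil, hjk, hjl, hkl, hall, h1, h2⟩ := diag_eq n
    refine ⟨_, _, _, _, hinj.ne hij, hinj.ne hik, hinj.ne hil, hinj.ne hjk, hinj.ne hjl,
      hinj.ne hkl, ?_, (pt_submodule_le_sup _).2 h1, (pt_submodule_le_sup _).2 h2⟩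
    refine Set.Subset.antisymm ?_ (by simp [Set.insert_subset_iff])
    rintro _ ⟨m, rfl⟩
    rcases hall m with rfl | rfl | rfl | rfl <;> simp

/-- The new basis consists of the vectors whose coordinates in `b` are the columns of `M`. -/
theorem exists_basis_vec_eq {W : Type*} [AddCommGroup W] [Module (ZMod 3) W]
    (b : Module.Basis (Fin 6) (ZMod 3) W) {M N : Matrix (Fin 6) (Fin 6) (ZMod 3)}
    (hMN : M * N = 1) (hNM : N * M = 1) (A : Matrix (Fin 6) (Fin 6) (ZMod 3)) :
    ∃ b' : Module.Basis (Fin 6) (ZMod 3) W, ∀ x,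
      vec b' A x = b.equivFun.symm (M.mulVec (row A x)) := by
  let f : (Fin 6 → ZMod 3) ≃ₗ[ZMod 3] (Fin 6 → ZMod 3) :=
    LinearEquiv.ofLinearMap N.mulVecLin M.mulVecLin
      (by rw [← Matrix.mulVecLin_mul, hNM, Matrix.mulVecLin_one])
      (by rw [← Matrix.mulVecLin_mul, hMN, Matrix.mulVecLin_one])
  have hf : ∀ v, f v = N.mulVec v := fun v => Matrix.mulVecLin_apply N v
  refine ⟨Module.Basis.ofEquivFun (b.equivFun.trans f), fun x => ?_⟩
  rw [vec, LinearEquiv.symm_apply_eq, Module.Basis.equivFun_ofEquivFun, LinearEquiv.trans_apply,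
    LinearEquiv.apply_symm_apply, hf, Matrix.mulVec_mulVec, hNM, Matrix.one_mulVec]

/-- The point model has the normal form. -/
theorem exists_modelK_eq_golaySet (hL : ∀ v, v ∈ L ↔ e.equivFun v 2 = 0) :
    ∃ b : Module.Basis (Fin 6) (ZMod 3) (Sym[ZMod 3]^2 V), modelK L = golaySet b := by
  obtain ⟨b, hvec⟩ := exists_basis_vec_eq (symBasis e) modelMatrix_mul_inv modelMatrixInv_mul conf
  have hrow : ∀ x, modelMatrix.mulVec (row conf x) ≠ 0 := fun x h => by
    have := vec_conf_ne_zero b x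
    rw [hvec, h, map_zero] at this
    exact this rfl
  have hpt : point (vec b conf) (vec_conf_ne_zero b) =
      fun x => pt (symBasis e) (modelMatrix.mulVec (row conf x)) (hrow x) := by
    ext x
    simp [point, pt, hvec]
  refine ⟨b, ?_⟩
  rw [golaySet, hpt, modelK, diagonalPoints_eq hL]
  ext q
  rw [Set.mem_union, mem_veronese_diff hL]
  constructor
  · rintro (⟨a, ha, h2, rfl⟩ | ⟨n, rfl⟩)
    · obtain ⟨x, t, -, h⟩ := exists_modelMatrix_of_ne_zero a h2
      exact ⟨x, (pt_eq_pt_of_eq_smul _ h).symm⟩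
    · obtain ⟨x, t, -, h⟩ := exists_modelMatrix_diag n
      exact ⟨x, (pt_eq_pt_of_eq_smul _ h).symm⟩
  · rintro ⟨x, rfl⟩
    rcases modelMatrix_row_cases x with ⟨a, b, c, t, -, hc, h⟩ | ⟨n, t, -, h⟩
    · exact Or.inl ⟨![a, b, c], fun h0 => hc (congrFun h0 2), hc, pt_eq_pt_of_eq_smul _ h⟩
    · exact Or.inr ⟨n, (pt_eq_pt_of_eq_smul _ h).symm⟩

/-- A basis of `L` followed by one of a complement reduces an arbitrary line to one fixed coordinate
line. -/
theorem exists_basis_mem_iff (hV : Module.finrank (ZMod 3) V = 3)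
    (hL : Module.finrank (ZMod 3) L = 2) :
    ∃ e : Module.Basis (Fin 3) (ZMod 3) V, ∀ v, v ∈ L ↔ e.equivFun v 2 = 0 := by
  have : FiniteDimensional (ZMod 3) V := Module.finite_of_finrank_pos (by omega)
  obtain ⟨Q, hQ⟩ := L.exists_isCompl
  have hQ1 : Module.finrank (ZMod 3) Q = 1 := by
    have := Submodule.finrank_add_eq_of_isCompl hQ
    omega
  let e := (((Module.finBasisOfFinrankEq (ZMod 3) L hL).prod
    (Module.finBasisOfFinrankEq (ZMod 3) Q hQ1)).map
      (L.prodEquivOfIsCompl Q hQ)).reindex finSumFinEquiv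
  refine ⟨e, fun v => ?_⟩
  have he : e.equivFun v 2 = (Module.finBasisOfFinrankEq (ZMod 3) Q hQ1).equivFun
      ((L.prodEquivOfIsCompl Q hQ).symm v).2 0 := by
    have h2 : (finSumFinEquiv (m := 2) (n := 1)).symm 2 = Sum.inr 0 := rfl
    simp [e, h2]
  rw [he]
  refine (Submodule.prodEquivOfIsCompl_symm_apply_snd_eq_zero L Q hQ (x := v)).symm.trans ?_
  rw [← LinearEquiv.map_eq_zero_iff (Module.finBasisOfFinrankEq (ZMod 3) Q hQ1).equivFun]
  refine ⟨fun h => congrFun h 0, fun h => funext fun i => ?_⟩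
  rwa [Subsingleton.elim i 0]

end Model

end WittVeronese

end

theorem mainTheorem5 {V : Type*} [AddCommGroup V] [Module (ZMod 3) V]
    (hV : Module.finrank (ZMod 3) V = 3)
    (L : Submodule (ZMod 3) V) (hL : Module.finrank (ZMod 3) L = 2) :
    WittVeronese.IsDesign 5 12 6 1
        (WittVeronese.modelK L) (WittVeronese.blocks (WittVeronese.modelK L)) ∧
      WittVeronese.DesignIso
        (WittVeronese.modelK L) (WittVeronese.blocks (WittVeronese.modelK L))
        Set.univ WittVeronese.wittBlocks ∧
      ∀ K' : Set (ℙ (ZMod 3) (Sym[ZMod 3]^2 V)),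
        WittVeronese.IsDesign 5 12 6 1 K' (WittVeronese.blocks K') →
          WittVeronese.ProjectivelyEquivalent (WittVeronese.modelK L) K' := by
  obtain ⟨e, he⟩ := WittVeronese.exists_basis_mem_iff hV hL
  obtain ⟨b, hb⟩ := WittVeronese.exists_modelK_eq_golaySet he
  rw [hb]
  refine ⟨WittVeronese.isDesign_golaySet b, WittVeronese.designIso_golaySet b, fun K' hK' => ?_⟩
  have hW : Module.finrank (ZMod 3) (Sym[ZMod 3]^2 V) = 6 := by
    rw [Module.finrank_eq_card_basis b, Fintype.card_fin]
  obtain ⟨b', rfl⟩ := WittVeronese.exists_eq_golaySet hW hK'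
  exact WittVeronese.projectivelyEquivalent_golaySet b b'
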